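/- Let $N\ge 0$ be an integer, let $f=(f_1,\dots,f_N)$ with $f_i\in\mathbb{Z}[x_1,\dots,x_N]$ be an endomorphism of the affine space $\mathbb{A}^N$ defined over $\mathbb{Z}$, and let $P\in\mathbb{A}^N(\mathbb{Z})=\mathbb{Z}^N$ be a periodic point of $f$, i.e. $f^n(P)=P$ for some $n\ge 1$. Let $p(N)$ be the largest prime number less than $2^N$ (for $N\le 1$ there is no such prime, and the product below is understood to be empty, i.e. equal to $1$). Then the size $|\mathcal{O}_f(P)|$ of the orbit $\mathcal{O}_f(P)=\{f^k(P):k\ge 0\}$ divides $$2^{2N}\prod_{\substack{p\ \text{prime}\\ 3\le p\le p(N)}}p^{2\lfloor N\log_p 2\rfloor}.$$ -/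

import Mathlib

/-- An endomorphism of affine `N`-space defined over `ℤ`: an `N`-tuple of polynomials in `N`
variables with integer coefficients. -/
abbrev AffineEnd (N : ℕ) : Type := Fin N → MvPolynomial (Fin N) ℤ

/-- The map induced on integral points: `P ↦ (f₁(P), …, f_N(P))`. -/
noncomputable def AffineEnd.onPoints {N : ℕ} (f : AffineEnd N) (P : Fin N → ℤ) : Fin N → ℤ :=
  fun i => MvPolynomial.eval P (f i)

/-- The forward orbit `{f^k(P) : k ≥ 0}` of a point under a self-map of a set. -/
def forwardOrbit {X : Type*} (f : X → X) (P : X) : Set X :=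
  {Q | ∃ k : ℕ, f^[k] P = Q}

/-- The largest prime number less than `2 ^ N`. For `N ≤ 1` there is none, and the value is `0`. -/
def largestPrimeBelowTwoPow (N : ℕ) : ℕ :=
  Nat.findGreatest (fun p => p.Prime ∧ p < 2 ^ N) (2 ^ N)

/-! Let `m` be the period of `P` mod 2, so `m ≤ 2^N`. A prime power dividing the full period splits
as `p^i · p^j` with `p^i ∣ m`, and some iterate `g` of `f` fixes `P` mod 2 with exact period `p^j`
(`exists_prime_pow_split`). Both factors must be bounded by `2^N`; for `p^i` this is counting.

The bound on `p^j` comes from linearizing. If `g P = P + d w`, then mod any divisor of `d` an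
iterate displaces `P` by `d (1 + A + ⋯ + A^(n-1)) w`, with `A` the Jacobian at `P`, so periodicity
makes this geometric sum kill `w`.

For odd `p`, apply this to the last nontrivial iterate: `w` becomes a nonzero vector mod 2 of exact
period `p^j` under `A`, hence `p^j ≤ 2^N` (`odd_prime_pow_minimalPeriod_le`).

For `p = 2`, the geometric sum is a power of the operator `A + 1`, nilpotent on `w`. So `g^(2^r)`
fixes `P` mod 4 once `N + 1 ≤ 2^r`, and an eigenvalue `-1` mod 4 is then excluded
(`iterate_two_pow_eq_self`), which rules out period `2^(r+2)`. This gives `j ≤ N` except when `N =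
1, j = 2` or `N = 2, j = 3`, which need second derivatives. -/

open Matrix

/-! ### Integral Taylor expansion and second derivatives -/

section Polynomials

variable {σ : Type*}

theorem MvPolynomial.exists_eval_add_smul_eq [Fintype σ] (p : MvPolynomial σ ℤ) (d : ℤ)
    (x z : σ → ℤ) :
    ∃ e : ℤ, eval (x + d • z) p =
      eval x p + d * ∑ i, eval x (pderiv i p) * z i + d ^ 2 * e := by
  classical
  induction p using MvPolynomial.induction_on with
  | C a => exact ⟨0, by simp⟩
  | add p q hp hq =>
    obtain ⟨e₁, h₁⟩ := hp
    obtain ⟨e₂, h₂⟩ := hq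
    refine ⟨e₁ + e₂, ?_⟩
    simp only [map_add, h₁, h₂, add_mul, Finset.sum_add_distrib]
    ring
  | mul_X p j hp =>
    obtain ⟨e, h⟩ := hp
    refine ⟨e * (x j + d * z j) + (∑ i, eval x (pderiv i p) * z i) * z j, ?_⟩
    have hs : ∑ i, eval x (pderiv i (p * X j)) * z i =
        (∑ i, eval x (pderiv i p) * z i) * x j + eval x p * z j := by
      simp only [Derivation.leibniz, pderiv_X, smul_eq_mul, map_add, map_mul, eval_X, add_mul,
        Finset.sum_add_distrib, Finset.sum_mul]
      rw [add_comm]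
      congr 1
      · exact Finset.sum_congr rfl fun i _ => by ring
      · simp [Pi.single_apply, apply_ite]
    rw [hs]
    simp only [map_mul, eval_X, h, Pi.add_apply, Pi.smul_apply, smul_eq_mul]
    ring

/-- Twice differentiating `X^n` produces the even factor `n(n-1)`. -/
theorem MvPolynomial.two_dvd_eval_pderiv_pderiv_self (p : MvPolynomial σ ℤ) (i : σ) (x : σ → ℤ) :
    2 ∣ eval x (pderiv i (pderiv i p)) := by
  classical
  induction p using MvPolynomial.induction_on with
  | C a => simp
  | add p q hp hq => simpa using dvd_add hp hq
  | mul_X p j hp =>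
    obtain ⟨c, hc⟩ := hp
    by_cases hij : j = i
    · subst hij
      refine ⟨c * x j + eval x (pderiv j p), ?_⟩
      simp [Derivation.leibniz, hc]
      ring
    · refine ⟨c * x j, ?_⟩
      simp [Derivation.leibniz, hc, pderiv_X, hij]
      ring

theorem MvPolynomial.pderiv_pderiv_comm (p : MvPolynomial σ ℤ) (i j : σ) :
    pderiv i (pderiv j p) = pderiv j (pderiv i p) := by
  classical
  induction p using MvPolynomial.induction_on with
  | C a => simp
  | add p q hp hq => simp [hp, hq]
  | mul_X p k hp =>
    have h (a b : σ) : pderiv (R := ℤ) a (pderiv b (X k)) = 0 := by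
      rw [pderiv_X]
      by_cases hk : k = b
      · subst hk; simp
      · simp [hk]
    simp only [Derivation.leibniz, map_add, smul_eq_mul, h, hp]
    ring

end Polynomials

/-! ### Reduction of integer vectors -/

section Reduction

variable {ι : Type*}

/-- Reduction modulo `c` of an integer vector. -/
def redVec (c : ℕ) (x : ι → ℤ) : ι → ZMod c := fun i => x i

theorem redVec_add (c : ℕ) (x y : ι → ℤ) : redVec c (x + y) = redVec c x + redVec c y := by
  ext i; simp [redVec]

theorem redVec_smul (c : ℕ) (d : ℤ) (x : ι → ℤ) :
    redVec c (d • x) = (d : ZMod c) • redVec c x := by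
  ext i; simp [redVec]

theorem redVec_eq_iff {c : ℕ} {x y : ι → ℤ} :
    redVec c x = redVec c y ↔ ∃ z, x = y + (c : ℤ) • z := by
  constructor
  · intro h
    have (i : ι) : (c : ℤ) ∣ x i - y i := by
      rw [← ZMod.intCast_zmod_eq_zero_iff_dvd]
      simpa [sub_eq_zero] using! congrFun h i
    choose z hz using this
    refine ⟨z, funext fun i => ?_⟩
    have := hz i
    simp only [Pi.add_apply, Pi.smul_apply, smul_eq_mul]
    linarith
  · rintro ⟨z, rfl⟩
    rw [redVec_add, redVec_smul]
    simp

theorem exists_eq_two_pow_smul {v : ι → ℤ} (hv : v ≠ 0) :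
    ∃ (k : ℕ) (w : ι → ℤ), v = (2 ^ k : ℤ) • w ∧ redVec 2 w ≠ 0 := by
  obtain ⟨i, hi⟩ := Function.ne_iff.1 hv
  have key : ∀ (n : ℕ) (v : ι → ℤ), v i ≠ 0 → (v i).natAbs ≤ n →
      ∃ (k : ℕ) (w : ι → ℤ), v = (2 ^ k : ℤ) • w ∧ redVec 2 w ≠ 0 := by
    intro n
    induction n with
    | zero => intro v h0 h1; simp at h1; exact absurd h1 h0
    | succ n ih =>
      intro v h0 h1
      by_cases h : redVec 2 v = 0
      · obtain ⟨z, hz⟩ := (redVec_eq_iff (c := 2) (x := v) (y := 0)).1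
          (by rw [h]; ext; simp [redVec])
        have hzi : v i = 2 * z i := by rw [hz]; simp
        obtain ⟨k, w, hw, hw'⟩ := ih z (by omega) (by omega)
        refine ⟨k + 1, w, ?_, hw'⟩
        rw [hz, hw, zero_add, smul_smul, pow_succ']
        rfl
      · exact ⟨0, v, by simp, h⟩
  exact key _ v hi le_rfl

theorem le_of_redVec_two_pow_smul_eq_zero {j k : ℕ} {w : ι → ℤ} (hw : redVec 2 w ≠ 0)
    (h : redVec (2 ^ j) ((2 ^ k : ℤ) • w) = 0) : j ≤ k := by
  by_contra! hlt
  apply hw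
  ext i
  have hi := congrFun h i
  simp only [redVec, Pi.smul_apply, smul_eq_mul, Pi.zero_apply] at hi ⊢
  rw [ZMod.intCast_zmod_eq_zero_iff_dvd] at hi ⊢
  have h1 : ((2 ^ (k + 1) : ℕ) : ℤ) ∣ 2 ^ k * w i :=
    (Int.natCast_dvd_natCast.2 (pow_dvd_pow 2 hlt)).trans hi
  push_cast at h1 ⊢
  rw [pow_succ] at h1
  exact (mul_dvd_mul_iff_left (by positivity)).1 h1

/-- If two distinct integer vectors agree modulo `2 ^ j`, their difference is `2 ^ k` times
a vector that is nonzero modulo `2`, with `j ≤ k`. -/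
theorem exists_eq_add_two_pow_smul {j : ℕ} {x y : ι → ℤ} (hne : y ≠ x)
    (h : redVec (2 ^ j) y = redVec (2 ^ j) x) :
    ∃ (k : ℕ) (w : ι → ℤ), j ≤ k ∧ y = x + (2 ^ k : ℤ) • w ∧ redVec 2 w ≠ 0 := by
  obtain ⟨k, w, hk, hw⟩ := exists_eq_two_pow_smul (sub_ne_zero.2 hne)
  have hy : y = x + (2 ^ k : ℤ) • w := by rw [← hk]; abel
  refine ⟨k, w, le_of_redVec_two_pow_smul_eq_zero hw ?_, hy, hw⟩
  rw [hy, redVec_add] at h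
  simpa using h

end Reduction

/-! ### Linearization of iterates -/

section Jacobian

variable {ι : Type*} [Fintype ι]

/-- `J x` is the linear part of the self-map `φ` of `ℤ^ι` at `x`, with integral remainders. -/
structure HasIntJacobian (φ : (ι → ℤ) → ι → ℤ) (J : (ι → ℤ) → Matrix ι ι ℤ) : Prop where
  expand : ∀ (d : ℤ) (x z : ι → ℤ), ∃ e, φ (x + d • z) = φ x + d • (J x *ᵥ z) + d ^ 2 • e
  congr : ∀ (d : ℤ) (x z : ι → ℤ), ∃ E, J (x + d • z) = J x + d • E

theorem HasIntJacobian.redVec_map_eq {φ : (ι → ℤ) → ι → ℤ}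
    {J : (ι → ℤ) → Matrix ι ι ℤ} (h : HasIntJacobian φ J) {c : ℕ} {x y : ι → ℤ}
    (hxy : redVec c x = redVec c y) : redVec c (φ x) = redVec c (φ y) := by
  obtain ⟨z, rfl⟩ := redVec_eq_iff.1 hxy
  obtain ⟨e, he⟩ := h.expand c y z
  rw [he, redVec_add, redVec_add, redVec_smul, redVec_smul]
  simp

theorem HasIntJacobian.redVec_iterate_eq {φ : (ι → ℤ) → ι → ℤ}
    {J : (ι → ℤ) → Matrix ι ι ℤ} (h : HasIntJacobian φ J) {c : ℕ} {x : ι → ℤ}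
    (hx : redVec c (φ x) = redVec c x)
    (n : ℕ) : redVec c (φ^[n] x) = redVec c x := by
  induction n with
  | zero => rfl
  | succ n ih => rw [Function.iterate_succ_apply', h.redVec_map_eq ih, hx]

variable [DecidableEq ι]

/-- The Jacobian of the iterates of `φ`, given by the chain rule. -/
def iterateJacobian (φ : (ι → ℤ) → ι → ℤ) (J : (ι → ℤ) → Matrix ι ι ℤ) :
    ℕ → (ι → ℤ) → Matrix ι ι ℤ
  | 0, _ => 1
  | n + 1, x => iterateJacobian φ J n (φ x) * J x

theorem HasIntJacobian.iterate {φ : (ι → ℤ) → ι → ℤ} {J : (ι → ℤ) → Matrix ι ι ℤ}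
    (h : HasIntJacobian φ J) (n : ℕ) : HasIntJacobian φ^[n] (iterateJacobian φ J n) := by
  induction n with
  | zero => exact ⟨fun d x z => ⟨0, by simp [iterateJacobian]⟩,
      fun d x z => ⟨0, by simp [iterateJacobian]⟩⟩
  | succ n ih =>
    refine ⟨fun d x z => ?_, fun d x z => ?_⟩
    · obtain ⟨e, he⟩ := h.expand d x z
      obtain ⟨e', he'⟩ := ih.expand d (φ x) (J x *ᵥ z + d • e)
      refine ⟨iterateJacobian φ J n (φ x) *ᵥ e + e', ?_⟩
      have : φ (x + d • z) = φ x + d • (J x *ᵥ z + d • e) := by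
        rw [he, smul_add, smul_smul, ← pow_two, add_assoc]
      rw [Function.iterate_succ_apply, Function.iterate_succ_apply, this, he', iterateJacobian,
        mulVec_add, mulVec_smul, mulVec_mulVec]
      module
    · obtain ⟨e, he⟩ := h.expand d x z
      obtain ⟨E, hE⟩ := h.congr d x z
      obtain ⟨E', hE'⟩ := ih.congr d (φ x) (J x *ᵥ z + d • e)
      refine ⟨iterateJacobian φ J n (φ x) * E + E' * J (x + d • z), ?_⟩
      have : φ (x + d • z) = φ x + d • (J x *ᵥ z + d • e) := by
        rw [he, smul_add, smul_smul, ← pow_two, add_assoc]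
      rw [iterateJacobian, iterateJacobian, this, hE', hE]
      simp only [add_mul, mul_add, smul_mul_assoc, mul_smul_comm, smul_add]
      abel

/-- Reduction modulo `c` of an integer matrix. -/
def redMat (c : ℕ) (M : Matrix ι ι ℤ) : Matrix ι ι (ZMod c) :=
  (Int.castRingHom (ZMod c)).mapMatrix M

theorem redVec_mulVec (c : ℕ) (M : Matrix ι ι ℤ) (x : ι → ℤ) :
    redVec c (M *ᵥ x) = redMat c M *ᵥ redVec c x := by
  ext i
  exact RingHom.map_mulVec (Int.castRingHom (ZMod c)) M x i

theorem redMat_mul (c : ℕ) (M M' : Matrix ι ι ℤ) : redMat c (M * M') = redMat c M * redMat c M' :=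
  map_mul _ _ _

theorem redMat_pow (c : ℕ) (M : Matrix ι ι ℤ) (n : ℕ) : redMat c (M ^ n) = redMat c M ^ n :=
  map_pow _ _ _

namespace HasIntJacobian

variable {φ : (ι → ℤ) → ι → ℤ} {J : (ι → ℤ) → Matrix ι ι ℤ}

theorem redMat_eq (h : HasIntJacobian φ J) {c : ℕ} {x y : ι → ℤ}
    (hxy : redVec c x = redVec c y) : redMat c (J x) = redMat c (J y) := by
  obtain ⟨z, rfl⟩ := redVec_eq_iff.1 hxy
  obtain ⟨E, hE⟩ := h.congr c y z
  rw [hE]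
  ext i j
  change ((J y i j + (c : ℤ) * E i j : ℤ) : ZMod c) = (J y i j : ZMod c)
  simp

/-- The orbit is constant mod `c`, so all factors in the chain rule agree mod `c`. -/
theorem redMat_iterateJacobian (h : HasIntJacobian φ J) {c : ℕ} {x y : ι → ℤ}
    (hx : redVec c (φ x) = redVec c x) (hyx : redVec c y = redVec c x) (n : ℕ) :
    redMat c (iterateJacobian φ J n y) = redMat c (J x) ^ n := by
  induction n generalizing y with
  | zero => simp [iterateJacobian, redMat]
  | succ n ih =>
    rw [iterateJacobian, redMat_mul, ih ((h.redVec_map_eq hyx).trans hx), h.redMat_eq hyx, pow_succ]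

/-- The quadratic remainder `d^2 e` still carries a factor `d` after division by `d`, so it vanishes
mod `c`. -/
theorem exists_iterate_eq (h : HasIntJacobian φ J) {c : ℕ} {d : ℤ} (hcd : (c : ℤ) ∣ d)
    {x w : ι → ℤ} (hx : φ x = x + d • w) (n : ℕ) :
    ∃ v, φ^[n] x = x + d • v ∧
      redVec c v = (∑ i ∈ Finset.range n, redMat c (J x) ^ i) *ᵥ redVec c w := by
  induction n with
  | zero => exact ⟨0, by simp, by ext; simp [redVec]⟩
  | succ n ih =>
    obtain ⟨v, hv, hv'⟩ := ih
    obtain ⟨e, he⟩ := h.expand d x v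
    refine ⟨w + J x *ᵥ v + d • e, ?_, ?_⟩
    · rw [Function.iterate_succ_apply', hv, he, hx]
      module
    · have hd : ((d : ℤ) : ZMod c) = 0 := (ZMod.intCast_zmod_eq_zero_iff_dvd _ _).2 hcd
      rw [redVec_add, redVec_add, redVec_smul, redVec_mulVec, hv', hd, zero_smul, add_zero,
        geom_sum_succ, add_mulVec, one_mulVec, mulVec_mulVec, add_comm]

theorem geom_sum_mulVec_eq_zero (h : HasIntJacobian φ J) {c : ℕ} {d : ℤ} (hd : d ≠ 0)
    (hcd : (c : ℤ) ∣ d) {x w : ι → ℤ} (hx : φ x = x + d • w) {n : ℕ} (hn : φ^[n] x = x) :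
    (∑ i ∈ Finset.range n, redMat c (J x) ^ i) *ᵥ redVec c w = 0 := by
  obtain ⟨v, hv, hv'⟩ := h.exists_iterate_eq hcd hx n
  rw [hn, left_eq_add, smul_eq_zero_iff_right hd] at hv
  rw [← hv', hv]
  ext
  simp [redVec]

end HasIntJacobian

theorem Matrix.pow_mulVec_eq_of_geom_sum_mulVec_eq_zero {R : Type*} [CommRing R]
    {D : Matrix ι ι R} {n : ℕ} {w : ι → R}
    (h : (∑ i ∈ Finset.range n, D ^ i) *ᵥ w = 0) : (D ^ n) *ᵥ w = w := by
  have : (D ^ n - 1) *ᵥ w = 0 := by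
    rw [← mul_geom_sum, ← mulVec_mulVec, h, mulVec_zero]
  rwa [sub_mulVec, one_mulVec, sub_eq_zero] at this

end Jacobian

/-! ### Frobenius and geometric sums in characteristic two -/

section CharTwo

variable {R : Type*} [Ring R]

theorem add_one_pow_two_pow_of_two_eq_zero (h : (2 : R) = 0) (a : R) (i : ℕ) :
    (a + 1) ^ 2 ^ i = a ^ 2 ^ i + 1 := by
  induction i with
  | zero => simp
  | succ i ih =>
    rw [pow_succ 2, pow_mul, ih, pow_mul]
    generalize a ^ 2 ^ i = b
    have hb : b + b = 0 := by rw [← two_mul, h, zero_mul]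
    rw [pow_two, add_mul, mul_add, mul_one, one_mul, add_assoc, ← add_assoc b b, hb, zero_add,
      ← pow_two]

theorem geom_sum_two_pow_of_two_eq_zero (h : (2 : R) = 0) (a : R) (i : ℕ) :
    ∑ t ∈ Finset.range (2 ^ i), a ^ t = (a + 1) ^ (2 ^ i - 1) := by
  induction i with
  | zero => simp
  | succ i ih =>
    have hpos : 0 < 2 ^ i := by positivity
    have hs : ∑ t ∈ Finset.range (2 ^ (i + 1)), a ^ t =
        (a ^ 2 ^ i + 1) * ∑ t ∈ Finset.range (2 ^ i), a ^ t := by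
      rw [pow_succ 2, mul_two, Finset.sum_range_add, add_mul, one_mul, Finset.mul_sum, add_comm]
      simp only [pow_add]
    rw [hs, ih, ← add_one_pow_two_pow_of_two_eq_zero h, ← pow_add]
    congr 1
    rw [pow_succ 2]
    omega

end CharTwo

/-! ### Matrices over the field with two elements -/

section LinearAlgebra

theorem Matrix.two_eq_zero_of_zmod_two {ι : Type*} [DecidableEq ι] :
    (2 : Matrix ι ι (ZMod 2)) = 0 := by
  ext i j
  rw [show (2 : Matrix ι ι (ZMod 2)) = 1 + 1 by norm_num, Matrix.add_apply]
  exact CharTwo.add_self_eq_zero _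

variable {ι : Type*} [Fintype ι] [DecidableEq ι]

theorem Matrix.pow_mulVec_eq_zero_of_card_le {K : Type*} [Field K] {M : Matrix ι ι K} {m k : ℕ}
    {w : ι → K} (h : (M ^ m) *ᵥ w = 0) (hk : Fintype.card ι ≤ k) : (M ^ k) *ᵥ w = 0 := by
  have h1 : w ∈ LinearMap.ker (M.toLin' ^ m) := by
    rw [LinearMap.mem_ker, ← toLin'_pow, toLin'_apply, h]
  have h2 := Module.End.ker_pow_le_ker_pow_finrank M.toLin' m h1
  rw [Module.finrank_fintype_fun_eq_card, LinearMap.mem_ker, ← toLin'_pow, toLin'_apply] at h2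
  rw [← Nat.sub_add_cancel hk, pow_add, ← mulVec_mulVec, h2, mulVec_zero]

/-- Being fixed by `A^(2^k)` means being killed by `(A + 1)^(2^k)`, and kernels of powers stabilize
by the dimension. -/
theorem Matrix.pow_two_pow_mulVec_eq_self {A : Matrix ι ι (ZMod 2)} {w : ι → ZMod 2} {i j : ℕ}
    (h : (A ^ 2 ^ i) *ᵥ w = w) (hj : Fintype.card ι ≤ 2 ^ j) : (A ^ 2 ^ j) *ᵥ w = w := by
  have key (k : ℕ) : ((A + 1) ^ 2 ^ k) *ᵥ w = 0 ↔ (A ^ 2 ^ k) *ᵥ w = w := by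
    rw [add_one_pow_two_pow_of_two_eq_zero two_eq_zero_of_zmod_two, add_mulVec, one_mulVec]
    exact ⟨fun h => funext fun i => CharTwo.add_eq_zero.1 (congrFun h i),
      fun h => funext fun i => CharTwo.add_eq_zero.2 (congrFun h i)⟩
  exact (key j).1 (pow_mulVec_eq_zero_of_card_le ((key i).2 h) hj)

theorem Matrix.iterate_mulVec {R : Type*} [CommRing R] (A : Matrix ι ι R) (n : ℕ) (w : ι → R) :
    (fun v => A *ᵥ v)^[n] w = (A ^ n) *ᵥ w := by
  induction n with
  | zero => simp
  | succ n ih => rw [Function.iterate_succ_apply', ih, pow_succ', mulVec_mulVec]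

end LinearAlgebra

/-! ### Prime power periods of points fixed mod 2 -/

namespace HasIntJacobian

variable {ι : Type*} [Fintype ι] [DecidableEq ι] {φ : (ι → ℤ) → ι → ℤ}
  {J : (ι → ℤ) → Matrix ι ι ℤ} {x : ι → ℤ}

theorem odd_prime_pow_minimalPeriod_le (h : HasIntJacobian φ J)
    (hx : redVec 2 (φ x) = redVec 2 x) {p t : ℕ} (hp : p.Prime) (hp2 : p ≠ 2)
    (hper : Function.minimalPeriod φ x = p ^ t) : p ^ t ≤ 2 ^ Fintype.card ι := by
  rcases t with _ | t
  · simpa using Nat.one_le_two_pow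
  have : Fact p.Prime := ⟨hp⟩
  have hG := h.iterate (p ^ t)
  have hne : φ^[p ^ t] x ≠ x := fun he => by
    have h1 := Function.IsPeriodicPt.minimalPeriod_dvd (f := φ) (n := p ^ t) (x := x) he
    rw [hper, Nat.pow_dvd_pow_iff_le_right hp.one_lt] at h1
    omega
  have hcyc : (φ^[p ^ t])^[p] x = x := by
    rw [← Function.iterate_mul, ← pow_succ, ← hper]
    exact Function.iterate_minimalPeriod
  obtain ⟨k, w, hk, hw, hw2⟩ := exists_eq_add_two_pow_smul (j := 1) hne
    (h.redVec_iterate_eq hx _)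
  have hsum := hG.geom_sum_mulVec_eq_zero (c := 2) (by positivity)
    (by exact_mod_cast dvd_pow_self 2 (by omega)) hw hcyc
  rw [h.redMat_iterateJacobian hx rfl] at hsum
  set A := redMat 2 (J x)
  have hfix := pow_mulVec_eq_of_geom_sum_mulVec_eq_zero hsum
  rw [← pow_mul, ← pow_succ] at hfix
  -- Otherwise the geometric sum would act on `w` as the odd number `p`, that is, as 1.
  have hnfix : (A ^ p ^ t) *ᵥ redVec 2 w ≠ redVec 2 w := fun hD => by
    have hDi (i : ℕ) : ((A ^ p ^ t) ^ i) *ᵥ redVec 2 w = redVec 2 w := by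
      induction i with
      | zero => simp
      | succ i ih => rw [pow_succ, ← mulVec_mulVec, hD, ih]
    rw [sum_mulVec] at hsum
    simp only [hDi, Finset.sum_const, Finset.card_range] at hsum
    obtain ⟨q, hq⟩ := hp.odd_of_ne_two hp2
    rw [hq, add_smul, one_smul, mul_comm, mul_smul, two_nsmul] at hsum
    rw [show redVec 2 w + redVec 2 w = 0 from
      funext fun i => CharTwo.add_self_eq_zero _, smul_zero,
      zero_add] at hsum
    exact hw2 hsum
  have hmin : Function.minimalPeriod (fun v => A *ᵥ v) (redVec 2 w) = p ^ (t + 1) := by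
    apply Function.minimalPeriod_eq_prime_pow
    · rw [Function.IsPeriodicPt, Function.IsFixedPt, iterate_mulVec]
      exact hnfix
    · rw [Function.IsPeriodicPt, Function.IsFixedPt, iterate_mulVec]
      exact hfix
  rw [← hmin]
  simpa using Function.minimalPeriod_le_card (f := fun v => A *ᵥ v) (x := redVec 2 w)

/-- With displacement `2a`, the sum of `2^s` powers is `(A + 1)^(2^s - 1)`; by nilpotency the
exponent `2^r - 1 ≥ N` already kills `a` mod 2. -/
theorem redVec_four_iterate_eq (h : HasIntJacobian φ J) (hx : redVec 2 (φ x) = redVec 2 x)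
    {r s : ℕ} (hper : φ^[2 ^ s] x = x) (hr : Fintype.card ι + 1 ≤ 2 ^ r) :
    redVec 4 (φ^[2 ^ r] x) = redVec 4 x := by
  obtain ⟨a, ha⟩ := redVec_eq_iff.1 hx
  have h1 := h.geom_sum_mulVec_eq_zero (c := 2) (by norm_num) (dvd_refl _) ha hper
  rw [geom_sum_two_pow_of_two_eq_zero two_eq_zero_of_zmod_two] at h1
  have h2 := pow_mulVec_eq_zero_of_card_le (k := 2 ^ r - 1) h1 (by omega)
  rw [← geom_sum_two_pow_of_two_eq_zero two_eq_zero_of_zmod_two] at h2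
  obtain ⟨v, hv, hv'⟩ := h.exists_iterate_eq (c := 2) (dvd_refl _) ha (2 ^ r)
  rw [h2] at hv'
  obtain ⟨z, hz⟩ := (redVec_eq_iff (c := 2) (x := v) (y := 0)).1
    (by rw [hv']; ext; simp [redVec])
  refine redVec_eq_iff.2 ⟨z, ?_⟩
  rw [hv, hz, zero_add, smul_smul]
  norm_num

/-- If the displacement of a point `x` of exact period `2` is divisible by `4`, then the
Jacobian at `x` has eigenvalue `-1` modulo `4` on a vector which is nonzero modulo `2`. -/
theorem exists_mulVec_eq_neg (h : HasIntJacobian φ J) (h4 : redVec 4 (φ x) = redVec 4 x)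
    (hne : φ x ≠ x) (hper : φ (φ x) = x) :
    ∃ w : ι → ℤ, redVec 2 w ≠ 0 ∧ redMat 4 (J x) *ᵥ redVec 4 w = - redVec 4 w := by
  obtain ⟨k, w, hk, hw, hw2⟩ := exists_eq_add_two_pow_smul (j := 2) hne h4
  refine ⟨w, hw2, ?_⟩
  have := h.geom_sum_mulVec_eq_zero (c := 4) (n := 2) (by positivity)
    (by exact_mod_cast pow_dvd_pow 2 hk) hw hper
  rw [Finset.sum_range_succ, Finset.sum_range_one, pow_zero, pow_one, add_mulVec, one_mulVec,
    add_comm] at this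
  exact eq_neg_of_add_eq_zero_left this

/-- Otherwise `D^2 w ≡ -w` mod 4 with `w ≢ 0` mod 2. But `D` fixes mod 2 both `w` and `u = (Dw -
w)/2`, so `D^2 w ≡ w` mod 4 and `2w ≡ 0` mod 4. -/
theorem iterate_two_pow_eq_self (h : HasIntJacobian φ J) (hx : redVec 2 (φ x) = redVec 2 x)
    {r : ℕ} (hr : Fintype.card ι ≤ 2 ^ r) (h4 : redVec 4 (φ^[2 ^ r] x) = redVec 4 x)
    (hper : φ^[2 ^ (r + 2)] x = x) : φ^[2 ^ (r + 1)] x = x := by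
  by_contra hne
  set G := φ^[2 ^ r] with hGdef
  set JG := iterateJacobian φ J (2 ^ r) with hJG
  have hG : HasIntJacobian G JG := h.iterate _
  have hGG : φ^[2 ^ (r + 1)] = G^[2] := by rw [pow_succ, Function.iterate_mul]
  have hGGG : φ^[2 ^ (r + 2)] = (G^[2])^[2] := by
    rw [pow_succ, Function.iterate_mul, ← hGG]
  rw [hGG] at hne
  rw [hGGG] at hper
  obtain ⟨w, hw2, hw⟩ := (hG.iterate 2).exists_mulVec_eq_neg (hG.redVec_iterate_eq h4 2) hne hper
  rw [hG.redMat_iterateJacobian h4 rfl, ← redMat_pow, ← redVec_mulVec] at hw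
  set D := JG x with hDdef
  have hD2 : redMat 2 D = redMat 2 (J x) ^ 2 ^ r := h.redMat_iterateJacobian hx rfl _
  obtain ⟨b, hb⟩ : ∃ b, (D ^ 2) *ᵥ w = -w + (4 : ℤ) • b := by
    apply redVec_eq_iff.1
    rw [hw]
    ext; simp [redVec]
  have hfour : (D ^ 4) *ᵥ w = w + (4 : ℤ) • ((D ^ 2) *ᵥ b - b) := by
    rw [show 4 = 2 + 2 from rfl, pow_add, ← mulVec_mulVec, hb, mulVec_add, mulVec_neg, hb,
      mulVec_smul]
    module
  have hlift {v : ι → ℤ} (hv : redVec 2 ((D ^ 4) *ᵥ v) = redVec 2 v) :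
      ∃ u, D *ᵥ v = v + (2 : ℤ) • u := by
    apply redVec_eq_iff.1
    rw [redVec_mulVec, redMat_pow, hD2, ← pow_mul, show 2 ^ r * 4 = 2 ^ (r + 2) by ring] at hv
    rw [redVec_mulVec, hD2, pow_two_pow_mulVec_eq_self hv hr]
  obtain ⟨u, hu⟩ := hlift (v := w) (redVec_eq_iff.2 ⟨(2 : ℤ) • ((D ^ 2) *ᵥ b - b), by
    rw [hfour]; module⟩)
  have hexp : (D ^ 4) *ᵥ w = w + (2 : ℤ) • (u + D *ᵥ u + (D ^ 2) *ᵥ u + (D ^ 3) *ᵥ u) := by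
    have e2 : (D ^ 2) *ᵥ w = w + (2 : ℤ) • (u + D *ᵥ u) := by
      rw [pow_two, ← mulVec_mulVec, hu, mulVec_add, mulVec_smul, hu]; module
    have e3 : (D ^ 3) *ᵥ w = w + (2 : ℤ) • (u + D *ᵥ u + (D ^ 2) *ᵥ u) := by
      rw [pow_succ, ← mulVec_mulVec, hu, mulVec_add, mulVec_smul, e2]; module
    rw [pow_succ, ← mulVec_mulVec, hu, mulVec_add, mulVec_smul, e3]; module
  have hgs : u + D *ᵥ u + (D ^ 2) *ᵥ u + (D ^ 3) *ᵥ u = (2 : ℤ) • ((D ^ 2) *ᵥ b - b) := by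
    have : (2 : ℤ) • (u + D *ᵥ u + (D ^ 2) *ᵥ u + (D ^ 3) *ᵥ u) =
        (2 : ℤ) • ((2 : ℤ) • ((D ^ 2) *ᵥ b - b)) := by
      rw [← add_right_inj w, ← hexp, hfour]; module
    exact smul_right_injective _ (by norm_num : (2 : ℤ) ≠ 0) this
  -- Applying `D - 1` to `hgs` shows that `D^4 u ≡ u` mod 2.
  obtain ⟨u', hu'⟩ := hlift (v := u) (redVec_eq_iff.2
    ⟨D *ᵥ ((D ^ 2) *ᵥ b - b) - ((D ^ 2) *ᵥ b - b), by
      have e := congrArg (fun v => D *ᵥ v) hgs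
      simp only [mulVec_add, mulVec_smul, mulVec_mulVec, ← pow_succ'] at e
      rw [← pow_two, show 2 + 1 = 3 from rfl, show 3 + 1 = 4 from rfl] at e
      rw [Nat.cast_ofNat, smul_sub, ← hgs, ← e]
      abel⟩)
  have hfin : (2 : ℤ) • w = (4 : ℤ) • (b - u - u') := by
    have e2 : (D ^ 2) *ᵥ w = w + (4 : ℤ) • (u + u') := by
      rw [pow_two, ← mulVec_mulVec, hu, mulVec_add, mulVec_smul, hu, hu']; module
    rw [e2] at hb
    rw [smul_sub, smul_sub, eq_sub_iff_add_eq, eq_sub_iff_add_eq, ← sub_eq_zero]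
    rw [← sub_eq_zero] at hb
    rw [← hb]; module
  apply hw2
  have : w = (2 : ℤ) • (b - u - u') := by
    apply smul_right_injective _ (by norm_num : (2 : ℤ) ≠ 0)
    simp only [hfin, smul_smul]
    norm_num
  rw [this, redVec_smul, show ((2 : ℤ) : ZMod 2) = 0 from rfl, zero_smul]

end HasIntJacobian

/-! ### Polynomial maps, and the exceptional case of the line -/

namespace AffineEnd

variable {N : ℕ}

/-- The Jacobian matrix of a polynomial map at an integral point. -/
noncomputable def jacobian (f : AffineEnd N) (x : Fin N → ℤ) : Matrix (Fin N) (Fin N) ℤ :=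
  Matrix.of fun i j => MvPolynomial.eval x (MvPolynomial.pderiv j (f i))

theorem hasIntJacobian (f : AffineEnd N) : HasIntJacobian f.onPoints f.jacobian := by
  constructor
  · intro d x z
    choose e he using fun i => MvPolynomial.exists_eval_add_smul_eq (f i) d x z
    exact ⟨e, funext he⟩
  · intro d x z
    choose e he using fun i j =>
      MvPolynomial.exists_eval_add_smul_eq (MvPolynomial.pderiv j (f i)) d x z
    refine ⟨Matrix.of fun i j => ∑ l, MvPolynomial.eval x
      (MvPolynomial.pderiv l (MvPolynomial.pderiv j (f i))) * z l + d * e i j, ?_⟩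
    ext i j
    rw [Matrix.add_apply, Matrix.smul_apply, smul_eq_mul, Matrix.of_apply]
    simp only [jacobian, Matrix.of_apply]
    rw [he]
    ring

theorem exists_onPoints_eq_iterate (f : AffineEnd N) (n : ℕ) :
    ∃ g : AffineEnd N, g.onPoints = f.onPoints^[n] := by
  induction n with
  | zero => exact ⟨MvPolynomial.X, by ext; simp [onPoints]⟩
  | succ n ih =>
    obtain ⟨g, hg⟩ := ih
    refine ⟨fun i => MvPolynomial.bind₁ f (g i), ?_⟩
    rw [Function.iterate_succ, ← hg]
    ext x i
    simp only [onPoints, Function.comp_apply]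
    exact MvPolynomial.eval₂Hom_bind₁ _ _ _ _

/-- Pure second derivatives are even, so mod 4 only mixed ones contribute. -/
theorem exists_jacobian_add_two_smul_eq (f : AffineEnd N) (x y : Fin N → ℤ) :
    ∃ E, f.jacobian (x + (2 : ℤ) • y) = f.jacobian x + (2 : ℤ) • (Matrix.of fun i j =>
      ∑ l ∈ Finset.univ.erase j, MvPolynomial.eval x
        (MvPolynomial.pderiv l (MvPolynomial.pderiv j (f i))) * y l) + (4 : ℤ) • E := by
  choose e he using fun i j =>
    MvPolynomial.exists_eval_add_smul_eq (MvPolynomial.pderiv j (f i)) 2 x y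
  choose c hc using fun i j => MvPolynomial.two_dvd_eval_pderiv_pderiv_self (f i) j x
  refine ⟨Matrix.of fun i j => c i j * y j + e i j, ?_⟩
  ext i j
  rw [Matrix.add_apply, Matrix.add_apply, Matrix.smul_apply, Matrix.smul_apply, smul_eq_mul,
    smul_eq_mul, Matrix.of_apply, Matrix.of_apply]
  simp only [jacobian, Matrix.of_apply]
  rw [he, ← Finset.add_sum_erase _ _ (Finset.mem_univ j), hc]
  ring

theorem iterate_two_eq_self_of_iterate_four (f : AffineEnd 1) {x : Fin 1 → ℤ}
    (hx : redVec 2 (f.onPoints x) = redVec 2 x) (hper : f.onPoints^[4] x = x) :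
    f.onPoints^[2] x = x := by
  by_contra hne
  have hJ := f.hasIntJacobian
  have h4 : redVec 4 (f.onPoints^[2] x) = redVec 4 x :=
    hJ.redVec_four_iterate_eq (r := 1) (s := 2) hx hper (by simp)
  obtain ⟨w, hw2, hw⟩ := (hJ.iterate 2).exists_mulVec_eq_neg h4 hne hper
  obtain ⟨a, ha⟩ := redVec_eq_iff.1 hx
  obtain ⟨E, hE⟩ := f.exists_jacobian_add_two_smul_eq x a
  have hJE : f.jacobian (f.onPoints x) 0 0 = f.jacobian x 0 0 + 4 * E 0 0 := by
    rw [ha]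
    have := congrFun (congrFun hE 0) 0
    rw [Matrix.add_apply, Matrix.add_apply, Matrix.smul_apply, Matrix.smul_apply] at this
    simpa using! this
  rw [← redVec_mulVec] at hw
  have hw0 := congrFun hw 0
  simp only [redVec, iterateJacobian, one_mul, mulVec, dotProduct, Matrix.mul_apply,
    Fin.sum_univ_one, hJE, Pi.neg_apply] at hw0
  have h40 : (4 : ZMod 4) = 0 := rfl
  push_cast at hw0
  rw [h40, zero_mul, add_zero] at hw0
  -- The Jacobian is the same mod 4 at both points of the orbit, and `-1` is not a square mod 4.
  have key : ∀ j v : ZMod 4, j * j * v = -v → 2 * v = 0 := by decide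
  have h2w : ((2 * w 0 : ℤ) : ZMod 4) = 0 := by
    push_cast
    exact key _ _ hw0
  rw [ZMod.intCast_zmod_eq_zero_iff_dvd] at h2w
  apply hw2
  ext i
  rw [Subsingleton.elim i 0]
  simp only [redVec, Pi.zero_apply]
  rw [ZMod.intCast_zmod_eq_zero_iff_dvd]
  omega

end AffineEnd

/-! ### Matrix computations for the exceptional case of the plane -/

section Plane

/-- Square the Cayley–Hamilton relation `A^2 = 2τ A - (2δ + 1)`. -/
theorem Matrix.exists_pow_four_eq_one_add {A : Matrix (Fin 2) (Fin 2) ℤ} (htr : Even A.trace)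
    (hdet : Odd A.det) : ∃ C, A ^ 4 = 1 + (4 : ℤ) • C := by
  obtain ⟨τ, hτ⟩ := htr
  obtain ⟨δ, hδ⟩ := hdet
  have h2 : A ^ 2 = A.trace • A - A.det • (1 : Matrix (Fin 2) (Fin 2) ℤ) := by
    ext i j
    rw [Matrix.sub_apply, Matrix.smul_apply, Matrix.smul_apply]
    fin_cases i <;> fin_cases j <;>
      simp [pow_two, Matrix.mul_apply, Fin.sum_univ_two, trace_fin_two, det_fin_two] <;> ring
  rw [hτ, hδ] at h2
  refine ⟨τ ^ 2 • A ^ 2 - (τ * (2 * δ + 1)) • A + (δ ^ 2 + δ) • 1, ?_⟩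
  rw [show 4 = 2 * 2 from rfl, pow_mul, h2, pow_two (_ - _), sub_mul, mul_sub, mul_sub]
  simp only [smul_mul_assoc, mul_smul_comm, mul_one, one_mul]
  rw [← pow_two A, h2]
  module

/-- The mixed part of the second-order term at a point of a map of the affine plane, where `b` is
the vector of mixed second derivatives. -/
def mixedHessian {R : Type*} [CommRing R] (b y : Fin 2 → R) : Matrix (Fin 2) (Fin 2) R :=
  !![b 0 * y 1, b 0 * y 0; b 1 * y 1, b 1 * y 0]

theorem redMat_mixedHessian (c : ℕ) (b y : Fin 2 → ℤ) :
    redMat c (mixedHessian b y) = mixedHessian (redVec c b) (redVec c y) := by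
  ext i j
  fin_cases i <;> fin_cases j <;> simp [redMat, redVec, mixedHessian]

/-- The hypotheses say `(A + 1) a ≠ 0` and `(A + 1)^3 a = 0`, so `A + 1` is nilpotent. -/
theorem plane_cycle_trace_det : ∀ (A : Matrix (Fin 2) (Fin 2) (ZMod 2)) (a : Fin 2 → ZMod 2),
    a + A *ᵥ a ≠ 0 → a + A *ᵥ (a + A *ᵥ (a + A *ᵥ a)) = 0 → A.trace = 0 ∧ A.det = 1 := by
  simp only [trace_fin_two, det_fin_two]
  decide

/-- The left side is the coefficient of 2 in the Jacobian of the fourth iterate, applied to `w`; it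
has no nonzero fixed vector. -/
theorem plane_cycle_eq_zero : ∀ (A : Matrix (Fin 2) (Fin 2) (ZMod 2)) (a : Fin 2 → ZMod 2),
    a + A *ᵥ a ≠ 0 → a + A *ᵥ (a + A *ᵥ (a + A *ᵥ a)) = 0 → ∀ b w : Fin 2 → ZMod 2,
    mixedHessian b (a + A *ᵥ (a + A *ᵥ a)) *ᵥ (A *ᵥ (A *ᵥ (A *ᵥ w))) +
      A *ᵥ (mixedHessian b (a + A *ᵥ a) *ᵥ (A *ᵥ (A *ᵥ w))) +
      A *ᵥ (A *ᵥ (mixedHessian b a *ᵥ (A *ᵥ w))) = w → w = 0 := by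
  decide +kernel

end Plane

/-! ### The exceptional case of the plane -/

namespace AffineEnd

theorem iterate_four_eq_self_of_iterate_eight (f : AffineEnd 2) {x : Fin 2 → ℤ}
    (hx : redVec 2 (f.onPoints x) = redVec 2 x) (hper : f.onPoints^[8] x = x) :
    f.onPoints^[4] x = x := by
  by_contra hne
  have hJ := f.hasIntJacobian
  have h4 : redVec 4 (f.onPoints^[4] x) = redVec 4 x :=
    hJ.redVec_four_iterate_eq (r := 2) (s := 3) hx hper (by simp)
  have h4' : redVec 4 (f.onPoints^[2] x) ≠ redVec 4 x := fun h =>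
    hne (hJ.iterate_two_pow_eq_self (r := 1) hx (by simp) h hper)
  obtain ⟨w, hw2, hw⟩ := (hJ.iterate 4).exists_mulVec_eq_neg h4 hne hper
  set A := f.jacobian x with hA
  obtain ⟨a, ha⟩ := redVec_eq_iff.1 hx
  have step (y : Fin 2 → ℤ) : ∃ y', f.onPoints (x + (2 : ℤ) • y) = x + (2 : ℤ) • y' ∧
      redVec 2 y' = redVec 2 a + redMat 2 A *ᵥ redVec 2 y := by
    obtain ⟨e, he⟩ := hJ.expand 2 x y
    refine ⟨a + A *ᵥ y + (2 : ℤ) • e, ?_, ?_⟩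
    · rw [he, ha, Nat.cast_ofNat]; module
    · rw [redVec_add, redVec_add, redVec_smul, redVec_mulVec,
        show ((2 : ℤ) : ZMod 2) = 0 from rfl, zero_smul, add_zero]
  have ha : f.onPoints x = x + (2 : ℤ) • a := ha
  obtain ⟨y₂, hf₂, hy₂⟩ := step a
  obtain ⟨y₃, hf₃, hy₃⟩ := step y₂
  obtain ⟨y₄, hf₄, hy₄⟩ := step y₃
  have two_smul_red {y : Fin 2 → ℤ} :
      redVec 4 (x + (2 : ℤ) • y) = redVec 4 x ↔ redVec 2 y = 0 := by
    rw [redVec_eq_iff, show (0 : Fin 2 → ZMod 2) = redVec 2 0 by ext; simp [redVec],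
      redVec_eq_iff]
    refine exists_congr fun z => ?_
    rw [add_right_inj, Nat.cast_ofNat, Nat.cast_ofNat, zero_add,
      show (4 : ℤ) = 2 * 2 from rfl, mul_smul]
    exact (smul_right_injective _ (by norm_num : (2 : ℤ) ≠ 0)).eq_iff
  have hit2 : f.onPoints^[2] x = x + (2 : ℤ) • y₂ := by
    simp only [Function.iterate_succ_apply, Function.iterate_zero_apply, ha, hf₂]
  have hit4 : f.onPoints^[4] x = x + (2 : ℤ) • y₄ := by
    simp only [Function.iterate_succ_apply, Function.iterate_zero_apply, ha, hf₂, hf₃, hf₄]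
  rw [hit2, Ne, two_smul_red, hy₂] at h4'
  rw [hit4, two_smul_red, hy₄, hy₃, hy₂] at h4
  obtain ⟨htr, hdet⟩ := plane_cycle_trace_det _ _ h4' h4
  obtain ⟨C, hC⟩ : ∃ C, A ^ 4 = 1 + (4 : ℤ) • C := by
    apply exists_pow_four_eq_one_add
    · rw [← ZMod.intCast_eq_zero_iff_even, ← htr]
      simp [trace_fin_two, redMat]
    · rw [← ZMod.intCast_eq_one_iff_odd, ← hdet]
      simp [det_fin_two, redMat]
  set b : Fin 2 → ℤ := fun i =>
    MvPolynomial.eval x (MvPolynomial.pderiv 0 (MvPolynomial.pderiv 1 (f i))) with hb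
  have hjac (y : Fin 2 → ℤ) : ∃ E, f.jacobian (x + (2 : ℤ) • y) =
      A + (2 : ℤ) • mixedHessian b y + (4 : ℤ) • E := by
    obtain ⟨E, hE⟩ := f.exists_jacobian_add_two_smul_eq x y
    refine ⟨E, ?_⟩
    rw [hE]
    congr 3
    have hb' (i : Fin 2) :
        MvPolynomial.eval x (MvPolynomial.pderiv 1 (MvPolynomial.pderiv 0 (f i))) = b i := by
      rw [MvPolynomial.pderiv_pderiv_comm]
    ext i j
    fin_cases j
    · fin_cases i <;> simp [mixedHessian, hb']
    · fin_cases i <;> simp [mixedHessian, hb]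
  obtain ⟨E₁, hE₁⟩ := hjac a
  obtain ⟨E₂, hE₂⟩ := hjac y₂
  obtain ⟨E₃, hE₃⟩ := hjac y₃
  have hprod : iterateJacobian f.onPoints f.jacobian 4 x =
      f.jacobian (x + (2 : ℤ) • y₃) * f.jacobian (x + (2 : ℤ) • y₂) *
        f.jacobian (x + (2 : ℤ) • a) * A := by
    simp only [iterateJacobian, ha, hf₂, hf₃, one_mul, hA]
  -- Since `A^4 ≡ 1` mod 4, the Jacobian of the fourth iterate is `1 + 2L` mod 4; eigenvalue `-1` on
  -- `w` then forces `L w ≡ w` mod 2.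
  set L := mixedHessian b y₃ * A * A * A + A * mixedHessian b y₂ * A * A +
    A * A * mixedHessian b a * A with hL
  obtain ⟨E, hE⟩ : ∃ E, iterateJacobian f.onPoints f.jacobian 4 x =
      1 + (2 : ℤ) • L + (4 : ℤ) • E := by
    have expand (M₁ M₂ M₃ : Matrix (Fin 2) (Fin 2) ℤ) : ∃ E,
        (A + (2 : ℤ) • M₃ + (4 : ℤ) • E₃) * (A + (2 : ℤ) • M₂ + (4 : ℤ) • E₂) *
        (A + (2 : ℤ) • M₁ + (4 : ℤ) • E₁) * A = A ^ 4 +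
          (2 : ℤ) • (M₃ * A * A * A + A * M₂ * A * A + A * A * M₁ * A) + (4 : ℤ) • E := by
      set J₁ := A + (2 : ℤ) • M₁ + (4 : ℤ) • E₁ with h₁
      set J₂ := A + (2 : ℤ) • M₂ + (4 : ℤ) • E₂ with h₂
      refine ⟨E₃ * J₂ * J₁ * A + (A + (2 : ℤ) • M₃) * E₂ * J₁ * A +
        (A + (2 : ℤ) • M₃) * (A + (2 : ℤ) • M₂) * E₁ * A +
        M₃ * M₂ * (A + (2 : ℤ) • M₁) * A + (M₃ * A + A * M₂) * M₁ * A, ?_⟩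
      rw [h₁, h₂]
      noncomm_ring
    obtain ⟨E, hE⟩ := expand (mixedHessian b a) (mixedHessian b y₂) (mixedHessian b y₃)
    refine ⟨C + E, ?_⟩
    rw [hprod, hE₁, hE₂, hE₃, hE, hC]
    module
  rw [← redVec_mulVec, show - redVec 4 w = redVec 4 (-w) by ext; simp [redVec],
    redVec_eq_iff] at hw
  obtain ⟨z, hz⟩ := hw
  apply hw2
  apply plane_cycle_eq_zero _ _ h4' h4 (redVec 2 b)
  have hLw : L *ᵥ w = w + (2 : ℤ) • (z - E *ᵥ w - w) := by
    apply smul_right_injective _ (by norm_num : (2 : ℤ) ≠ 0)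
    rw [hE, add_mulVec, add_mulVec, one_mulVec, smul_mulVec, smul_mulVec, Nat.cast_ofNat] at hz
    simp only
    rw [← sub_eq_zero] at hz ⊢
    rw [← hz]
    module
  have := congrArg (redVec 2) hLw
  rw [redVec_add, redVec_smul, show ((2 : ℤ) : ZMod 2) = 0 from rfl, zero_smul, add_zero, hL,
    add_mulVec, add_mulVec, redVec_add, redVec_add] at this
  simpa only [redVec_mulVec, redMat_mul, redMat_mixedHessian, ← mulVec_mulVec, hy₃, hy₂]
    using this

end AffineEnd

/-! ### Assembling the bounds -/

namespace AffineEnd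

variable {N : ℕ}

theorem two_pow_minimalPeriod_le (f : AffineEnd N) {x : Fin N → ℤ}
    (hx : redVec 2 (f.onPoints x) = redVec 2 x) {s : ℕ}
    (hper : Function.minimalPeriod f.onPoints x = 2 ^ s) : s ≤ N := by
  have hJ := f.hasIntJacobian
  have hs : f.onPoints^[2 ^ s] x = x := by
    rw [← hper]; exact Function.iterate_minimalPeriod
  have hmin {r : ℕ} (hr : f.onPoints^[2 ^ r] x = x) : s ≤ r := by
    have h1 := Function.IsPeriodicPt.minimalPeriod_dvd (f := f.onPoints) (n := 2 ^ r) (x := x) hr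
    rwa [hper, Nat.pow_dvd_pow_iff_le_right (by norm_num)] at h1
  have general {r : ℕ} (hr : N + 1 ≤ 2 ^ r) (hsr : s = r + 2) : False := by
    subst hsr
    have := hmin (hJ.iterate_two_pow_eq_self (r := r) hx (by simp; omega)
      (hJ.redVec_four_iterate_eq hx hs (by simpa using hr)) hs)
    omega
  by_contra! hlt
  by_cases hbig : N + 1 ≤ 2 ^ (s - 2) ∧ 2 ≤ s
  · exact general hbig.1 (by omega)
  -- For `s > N` the general argument with `r = s - 2` fails only here.
  have hcases : N = 0 ∨ N = 1 ∧ s = 2 ∨ N = 2 ∧ s = 3 := by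
    by_contra! hc
    apply hbig
    refine ⟨?_, by omega⟩
    by_cases hN : s = N + 1
    · obtain ⟨k, rfl⟩ : ∃ k, N = k + 3 := ⟨N - 3, by omega⟩
      subst hN
      have h2 : k < 2 ^ k := Nat.lt_two_pow_self
      have e : 2 ^ (k + 2) = 4 * 2 ^ k := by rw [pow_add]; ring
      rw [show k + 3 + 1 - 2 = k + 2 by omega]
      omega
    · calc N + 1 ≤ 2 ^ N := Nat.lt_two_pow_self
        _ ≤ 2 ^ (s - 2) := Nat.pow_le_pow_right (by norm_num) (by omega)
  rcases hcases with rfl | ⟨rfl, rfl⟩ | ⟨rfl, rfl⟩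
  · have := hmin (r := 0) (Subsingleton.elim _ _)
    omega
  · have := hmin (r := 1) (f.iterate_two_eq_self_of_iterate_four hx hs)
    omega
  · have := hmin (r := 2) (f.iterate_four_eq_self_of_iterate_eight hx hs)
    omega

/-- The period of the reduction modulo `2` of a periodic point. -/
theorem exists_period_mod_two (f : AffineEnd N) (x : Fin N → ℤ)
    (hx : x ∈ Function.periodicPts f.onPoints) :
    ∃ m, m ∣ Function.minimalPeriod f.onPoints x ∧ 0 < m ∧ m ≤ 2 ^ N ∧
      redVec 2 (f.onPoints^[m] x) = redVec 2 x := by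
  classical
  let g : (Fin N → ZMod 2) → Fin N → ZMod 2 := fun v i =>
    MvPolynomial.eval₂ (Int.castRingHom (ZMod 2)) v (f i)
  have hg : Function.Semiconj (redVec 2) f.onPoints g := fun y => by
    ext i
    exact (MvPolynomial.eval₂_comp_left (Int.castRingHom (ZMod 2)) (RingHom.id ℤ) y (f i)).trans
      (by rfl)
  have hper (n : ℕ) (hn : f.onPoints^[n] x = x) :
      Function.IsPeriodicPt g n (redVec 2 x) := by
    rw [Function.IsPeriodicPt, Function.IsFixedPt, ← (hg.iterate_right n).eq, hn]
  have hx2 : redVec 2 x ∈ Function.periodicPts g :=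
    ⟨_, Function.minimalPeriod_pos_of_mem_periodicPts hx,
      hper _ Function.iterate_minimalPeriod⟩
  refine ⟨Function.minimalPeriod g (redVec 2 x),
    (hper _ Function.iterate_minimalPeriod).minimalPeriod_dvd,
    Function.minimalPeriod_pos_of_mem_periodicPts hx2, ?_, ?_⟩
  · simpa using Function.minimalPeriod_le_card (f := g) (x := redVec 2 x)
  · rw [(hg.iterate_right _).eq]
    exact Function.iterate_minimalPeriod

/-- A prime power dividing the period of `x` splits into a divisor of the period modulo `2` and
the period of `x` under an iterate fixing `x` modulo `2`. -/
theorem exists_prime_pow_split (f : AffineEnd N) {x : Fin N → ℤ}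
    (hx : x ∈ Function.periodicPts f.onPoints) {p k : ℕ} (hp : p.Prime)
    (hk : p ^ k ∣ Function.minimalPeriod f.onPoints x) :
    ∃ (i j : ℕ) (g : AffineEnd N), k = i + j ∧ p ^ i ≤ 2 ^ N ∧
      redVec 2 (g.onPoints x) = redVec 2 x ∧ Function.minimalPeriod g.onPoints x = p ^ j := by
  obtain ⟨m, ⟨n', hn'⟩, hm0, hm, hm2⟩ := f.exists_period_mod_two x hx
  have hpos := Function.minimalPeriod_pos_of_mem_periodicPts hx
  rw [hn'] at hk
  obtain ⟨u, v, hu, hv, huv⟩ := (Nat.dvd_mul).1 hk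
  obtain ⟨i, -, rfl⟩ := (Nat.dvd_prime_pow hp).1 (Dvd.intro _ huv)
  obtain ⟨j, -, rfl⟩ := (Nat.dvd_prime_pow hp).1 (Dvd.intro_left _ huv)
  obtain ⟨c, hc⟩ := hv
  obtain ⟨g, hg⟩ := f.exists_onPoints_eq_iterate (m * c)
  have hn : Function.minimalPeriod f.onPoints x = m * c * p ^ j := by rw [hn', hc]; ring
  refine ⟨i, j, g, ?_, (Nat.le_of_dvd hm0 hu).trans hm, ?_, ?_⟩
  · rw [← pow_add] at huv
    exact (Nat.pow_right_injective hp.two_le huv).symm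
  · rw [hg, Function.iterate_mul]
    exact (f.hasIntJacobian.iterate m).redVec_iterate_eq hm2 c
  · have hmc : 0 < m * c := by
      rw [hn] at hpos
      exact Nat.pos_of_mul_pos_right hpos
    rw [hg, Function.minimalPeriod_iterate_eq_div_gcd hmc.ne', hn, Nat.gcd_mul_right_left,
      Nat.mul_div_cancel_left _ hmc]

end AffineEnd

theorem ncard_forwardOrbit {X : Type*} (f : X → X) (x : X) (hx : x ∈ Function.periodicPts f) :
    (forwardOrbit f x).ncard = Function.minimalPeriod f x := by
  have hpos := Function.minimalPeriod_pos_of_mem_periodicPts hx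
  have : forwardOrbit f x = (fun n => f^[n] x) '' Set.Iio (Function.minimalPeriod f x) := by
    ext y
    constructor
    · rintro ⟨k, rfl⟩
      exact ⟨k % Function.minimalPeriod f x, Nat.mod_lt _ hpos,
        Function.iterate_mod_minimalPeriod_eq⟩
    · rintro ⟨k, -, rfl⟩
      exact ⟨k, rfl⟩
  rw [this, Set.InjOn.ncard_image Function.iterate_injOn_Iio_minimalPeriod]
  simp [Set.ncard_eq_toFinset_card']

theorem le_floor_mul_logb_of_pow_le {p i N : ℕ} (hp : 1 < p) (h : p ^ i ≤ 2 ^ N) :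
    i ≤ ⌊(N : ℝ) * Real.logb p 2⌋₊ := by
  have hp' : (1 : ℝ) < p := by exact_mod_cast hp
  apply Nat.le_floor
  rw [← Real.logb_pow, Real.le_logb_iff_rpow_le hp' (by positivity), Real.rpow_natCast]
  exact_mod_cast h

theorem le_largestPrimeBelowTwoPow {p N : ℕ} (hp : p.Prime) (h : p < 2 ^ N) :
    p ≤ largestPrimeBelowTwoPow N :=
  Nat.le_findGreatest h.le ⟨hp, h⟩

theorem theorem3p2 (N : ℕ) (f : AffineEnd N) (P : Fin N → ℤ)
    (hP : P ∈ Function.periodicPts f.onPoints) :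
    (forwardOrbit f.onPoints P).ncard ∣
      2 ^ (2 * N) *
        ∏ p ∈ (Finset.Icc 3 (largestPrimeBelowTwoPow N)).filter Nat.Prime,
          p ^ (2 * ⌊(N : ℝ) * Real.logb (p : ℝ) 2⌋₊) := by
  rw [ncard_forwardOrbit _ _ hP, Nat.dvd_iff_prime_pow_dvd_dvd]
  intro p k hp hk
  obtain ⟨i, j, g, rfl, hi, hg, hj⟩ := f.exists_prime_pow_split hP hp hk
  by_cases hp2 : p = 2
  · subst hp2
    have hi' : i ≤ N := (Nat.pow_le_pow_iff_right (by norm_num)).1 hi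
    have hj' := g.two_pow_minimalPeriod_le hg hj
    exact (pow_dvd_pow 2 (by omega)).mul_right _
  have hj' : p ^ j ≤ 2 ^ N := by
    simpa using g.hasIntJacobian.odd_prime_pow_minimalPeriod_le hg hp hp2 hj
  rcases Nat.eq_zero_or_pos (i + j) with h0 | h0
  · simp [h0]
  have hple : p ≤ 2 ^ N := by
    rcases Nat.eq_zero_or_pos i with hi0 | hi0
    · exact (Nat.le_self_pow (by omega) p).trans hj'
    · exact (Nat.le_self_pow (by omega) p).trans hi
  -- Equality would make the odd prime `p` divide a power of 2.
  have hlt : p < 2 ^ N := hple.lt_of_ne fun he =>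
    hp2 ((Nat.prime_dvd_prime_iff_eq hp Nat.prime_two).1 (hp.dvd_of_dvd_pow he.dvd))
  have hmem : p ∈ (Finset.Icc 3 (largestPrimeBelowTwoPow N)).filter Nat.Prime := by
    have := hp.two_le
    simp only [Finset.mem_filter, Finset.mem_Icc]
    exact ⟨⟨by omega, le_largestPrimeBelowTwoPow hp hlt⟩, hp⟩
  refine Dvd.dvd.mul_left (dvd_trans (pow_dvd_pow p ?_) (Finset.dvd_prod_of_mem
    (fun q : ℕ => q ^ (2 * ⌊(N : ℝ) * Real.logb (q : ℝ) 2⌋₊)) hmem)) _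
  have h1 := le_floor_mul_logb_of_pow_le hp.one_lt hi
  have h2 := le_floor_mul_logb_of_pow_le hp.one_lt hj'
  omega
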